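/- All graphs are finite, simple and connected, and every player may also stay on his vertex. In the game with $k$ cops and $m\ge 1$ robbers on a graph $G$, the cops choose their starting vertices first and the robbers choose theirs afterwards (round $0$). In each later round all cops move (each to an adjacent vertex or staying put), and then all robbers that have not been captured move in the same way. Whenever a cop and some robbers occupy the same vertex, these robbers are captured and leave the game. All positions are visible to all players. The capture time $\operatorname{capt}_k(G,m)$ is the least $t$ such that the cops can guarantee that the last robber is captured in round $t$ or earlier ($\infty$ if there is no such $t$); write $\operatorname{capt}(G,m)=\operatorname{capt}_1(G,m)$. The graph $G$ is strong cop-win if $\lim_{m\to\infty}\operatorname{capt}(G,m)$ exists (as a finite number). Let $H(7)$ be the graph on $\{1,\dots,7\}$ that consists of the path $6,2,1,4$, two vertices $5$ and $3$, each adjacent to all four vertices of the path, and a vertex $7$ adjacent to $6$, $4$ and $3$. For $n\ge 8$, let $H(n)$ be obtained from $H(n-1)$ by adding a vertex $n$ adjacent to $n-1$, $n-3$ and $n-4$. **Theorem.** Let $n=4\ell+2$ with $\ell\ge 2$. Then $\operatorname{capt}(H(n),m)$ is finite for every $m\ge 1$, but $$\operatorname{capt}(H(n),3^s)\ \ge\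 s(\ell+n-4)\qquad\text{for every integer } s\ge 1.$$ In particular $\operatorname{capt}(H(n),m)$, $m\ge 1$, is unbounded, and $H(n)$ is not strong cop-win. -/

import Mathlib

open Filter Topology

/-! The game of `k` cops and `m` robbers on a graph `G`. Graphs are simple graphs in which every
vertex is regarded as carrying a loop, so that a player may stay on the vertex he occupies. -/

namespace CopsRobbers

variable {V : Type*}

/-- One move of one player: stay on the vertex or move to an adjacent vertex. -/
def Step (G : SimpleGraph V) (u v : V) : Prop := u = v ∨ G.Adj u v

/-- All cops make a move, from the position `c` to the position `c'`. -/
def CopsMove (G : SimpleGraph V) {k : ℕ} (c c' : Fin k → V) : Prop :=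
  ∀ i, Step G (c i) (c' i)

/-- A position of the robbers assigns to each robber his vertex, or `none` if he has been captured.
All robbers that are still in the game make a move; captured robbers do not continue playing. -/
def RobbersMove (G : SimpleGraph V) {m : ℕ} (r r' : Fin m → Option V) : Prop :=
  ∀ j, Option.Rel (Step G) (r j) (r' j)

open Classical in
/-- Every robber whose vertex is occupied by a cop is captured. -/
noncomputable def capture {k m : ℕ} (c : Fin k → V) (r : Fin m → Option V) : Fin m → Option V :=
  fun j => if ∃ i, r j = some (c i) then none else r j

/-- `CopsWinIn G t c r`: from the position in which the cops are on `c`, the robbers are on `r`, and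
a new round is about to start, the cops can guarantee that all robbers are captured after at most
`t` further rounds. In a round all cops move, the robbers they meet are captured, all remaining
robbers move, and the robbers that moved onto a cop are captured. The cops see the robbers'
positions, and the robbers see the cops' move before they answer it. -/
def CopsWinIn (G : SimpleGraph V) {k m : ℕ} : ℕ → (Fin k → V) → (Fin m → Option V) → Prop
  | 0, _, r => ∀ j, r j = none
  | t + 1, c, r => (∀ j, r j = none) ∨
      ∃ c', CopsMove G c c' ∧
        ∀ r', RobbersMove G (capture c' r) r' → CopsWinIn G t c' (capture c' r')

/-- The cops can guarantee that the last of the `m` robbers is captured in round `t` or earlier. In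
round 0 the cops choose their vertices first, and the robbers choose theirs afterwards. -/
def CopsGuarantee (G : SimpleGraph V) (k m t : ℕ) : Prop :=
  ∃ c : Fin k → V, ∀ r : Fin m → V, CopsWinIn G t c (capture c (fun j => some (r j)))

/-- The capture time of the game with `k` cops and `m` robbers on `G`: the least `t` such that the
cops can guarantee to capture the last robber in round `t` or earlier, and `⊤` if there is no such
`t`. -/
noncomputable def capt (G : SimpleGraph V) (k m : ℕ) : ℕ∞ :=
  sInf ((fun t : ℕ => (t : ℕ∞)) '' {t : ℕ | CopsGuarantee G k m t})

/-- `G` is strong `k`-cop-win: the capture times with `k` cops and `m` robbers have a (finite) limit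
as `m` tends to infinity. -/
def IsStrongCopWin (G : SimpleGraph V) (k : ℕ) : Prop :=
  ∃ L : ℕ, Tendsto (fun m : ℕ => capt G k m) atTop (𝓝 (L : ℕ∞))

end CopsRobbers

/-- The edges of `H(7)`, larger endpoint first: the path `6, 2, 1, 4`; the vertices `5` and `3`, each
adjacent to all vertices of the path; the vertex `7`, adjacent to `6`, `4` and `3`. -/
def edgesH7 : Finset (ℕ × ℕ) :=
  {(6, 2), (2, 1), (4, 1),
   (6, 5), (5, 2), (5, 1), (5, 4),
   (6, 3), (3, 2), (3, 1), (4, 3),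
   (7, 6), (7, 4), (7, 3)}

/-- `a b` is an edge with larger endpoint `a`: an edge of `H(7)`, or an edge that joins a vertex
`a ≥ 8`, at the moment it is added, to `a - 1`, `a - 3` or `a - 4`. -/
def EdgeH (a b : ℕ) : Prop :=
  (a, b) ∈ edgesH7 ∨ (8 ≤ a ∧ (b + 1 = a ∨ b + 3 = a ∨ b + 4 = a))

/-- The graph `H(n)` for `n ≥ 7`, on the vertices `1, …, n`. -/
def graphH (n : ℕ) : SimpleGraph (Set.Icc 1 n) where
  Adj u v := EdgeH u v ∨ EdgeH v u
  symm := ⟨fun _ _ h => h.symm⟩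
  loopless := ⟨fun u h => by
    have key : ∀ a : ℕ, ¬ EdgeH a a := by
      rintro a (h | h)
      · simp only [edgesH7, Finset.mem_insert, Finset.mem_singleton, Prod.mk.injEq] at h
        omega
      · omega
    exact h.elim (key _) (key _)⟩

open CopsRobbers

/-! Two vertices of H(n) are adjacent iff they differ by 1, 3 or 4, or form the exceptional pair {1,
3}. The vertex k + 1 is a corner of H(k + 1), dominated by k - 3, and folding corners one at a time
gives the retractions `shadow k`.

Cop: chase a single robber and ignore the others. From 1 the cop steps onto the robber's image in
{1, …, 5}, and then stays on its images in H(6), H(7), …, H(n), the last of which is the robber.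
Since this works from any position, induction on the number of free robbers makes the capture time
finite (`copsWinIn_of_near_shadow`, `copsWinIn_of_cop_le`).

Robbers: a group on one vertex v ≤ k, not near the cop's shadow in H(k), can repeat this with k + 1
after each round. Once k = n, it can be cornered only on n by a cop on n - 4
(`exists_near_not_near`, `evades_of_corner`). It then splits between n - 1 and n - 3. If the cop
takes neither half, the halves reunite out of reach; if the cop takes one, the other is at
difference 2 and keeps it until the cop has walked down to 1 or 2, when a new climb from level 6
starts. So each halving costs the cop 1 round to take a half, at least l to descend and n - 5 to
climb, that is n + l - 4 in all (`evades_of_level`). Halving needs only 2 ^ s robbers. -/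

/-- Equality or adjacency in the graphs `H(n)`. -/
def Near (a b : ℕ) : Prop :=
  a = b ∨ a + 1 = b ∨ a + 3 = b ∨ a + 4 = b ∨ b + 1 = a ∨ b + 3 = a ∨ b + 4 = a ∨
    (a = 1 ∧ b = 3) ∨ (a = 3 ∧ b = 1)

/-- H(7) already follows the rule by which later vertices are attached, except for the extra edge
1–3, so no case distinction at 8 is needed. -/
theorem edgeH_iff {a b : ℕ} (hb : 1 ≤ b) :
    EdgeH a b ↔ b + 1 = a ∨ b + 3 = a ∨ b + 4 = a ∨ (b = 1 ∧ a = 3) := by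
  constructor
  · unfold EdgeH edgesH7
    simp only [Finset.mem_insert, Finset.mem_singleton, Prod.mk.injEq]
    rintro (h | h)
    · rcases h with h | h | h | h | h | h | h | h | h | h | h | h | h | h <;> omega
    · omega
  · intro h
    by_cases ha : 8 ≤ a
    · exact Or.inr (by omega)
    · left
      have ha' : a ≤ 7 := by omega
      have hb' : b ≤ 6 := by omega
      interval_cases b <;> interval_cases a <;> first | decide | omega

theorem step_graphH_iff {n : ℕ} (u v : Set.Icc 1 n) :
    Step (graphH n) u v ↔ Near u v := by
  have hu := u.2.1
  have hv := v.2.1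
  have : (graphH n).Adj u v ↔ EdgeH u v ∨ EdgeH v u := Iff.rfl
  rw [Step, this, edgeH_iff hv, edgeH_iff hu, Near, Subtype.ext_iff]
  omega

/-! ### Retractions and corners -/

/-- The retraction of `H(n)` onto `H(k)` that moves vertices above `k` down by multiples of `4`. -/
def shadow (k x : ℕ) : ℕ := if x ≤ k then x else (k - 3) + (x - (k - 3)) % 4

theorem shadow_of_le {k x : ℕ} (h : x ≤ k) : shadow k x = x := if_pos h

theorem shadow_near {k x y : ℕ} (hk : 6 ≤ k) (h : Near x y) :
    Near (shadow k x) (shadow k y) := by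
  unfold Near shadow at *
  rcases h with h | h | h | h | h | h | h | h | h <;> split_ifs <;> omega

theorem shadow_pos {k x : ℕ} (hk : 6 ≤ k) (hx : 1 ≤ x) : 1 ≤ shadow k x := by
  unfold shadow; split_ifs <;> omega

theorem shadow_le {k x : ℕ} (hk : 6 ≤ k) : shadow k x ≤ k := by
  unfold shadow; split_ifs <;> omega

/-- `shadow k` is `shadow (k + 1)` followed by the fold of k + 1 onto k - 3, and this fold fixes
every v ≤ k. -/
theorem shadow_eq_of_shadow_succ_eq {k x v : ℕ} (hk : 6 ≤ k) (hv : v ≤ k)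
    (h : shadow (k + 1) x = v) : shadow k x = v := by
  unfold shadow at *; split_ifs at * <;> omega

/-- The two shadows of y differ only if the upper one is the corner k + 1, whose neighbours k, k - 2
and k - 3 are all near k - 3. This lets a cop on a robber's shadow answer the robber's move and
raise the level by one. -/
theorem shadow_near_shadow_succ {k x y : ℕ} (hk : 6 ≤ k) (h : Near x y) :
    Near (shadow k x) (shadow (k + 1) y) := by
  unfold Near shadow at *
  rcases h with h | h | h | h | h | h | h | h | h <;> split_ifs <;> omega

/-- In `H(k)`, only the vertex `k` is dominated by another vertex, namely by `k - 4`. -/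
theorem exists_near_not_near {k u v : ℕ} (hk : 7 ≤ k) (hu : 1 ≤ u) (hv : 1 ≤ v) (huk : u ≤ k)
    (hvk : v ≤ k) (huv : u ≠ v) (h : ¬ (v = k ∧ u + 4 = k)) :
    ∃ w, 1 ≤ w ∧ w ≤ k ∧ Near v w ∧ ¬ Near u w := by
  by_cases hn : Near u v
  swap
  · exact ⟨v, hv, hvk, Or.inl rfl, hn⟩
  unfold Near at *
  by_cases h1 : u = 1
  -- Within {1, …, 6} only 6 is not near 1. It is not near 4 either, which is why 7 must be present.
  · subst h1
    by_cases h4 : v = 4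
    · exact ⟨7, by omega⟩
    · exact ⟨6, by omega⟩
  by_cases h2 : v = 1
  · by_cases h5 : u = 5
    · exact ⟨3, by omega⟩
    · by_cases h3 : u = 3
      · exact ⟨5, by omega⟩
      · by_cases h2 : u = 2
        · exact ⟨4, by omega⟩
        · exact ⟨2, by omega⟩
  -- Each witness differs from u by 2 or 5. For v = u + 4 it is v + 1, which is missing exactly when
  -- v = k.
  rcases hn with hn | hn | hn | hn | hn | hn | hn | hn | hn
  · omega
  · by_cases hvk' : v = k
    · exact ⟨v - 3, by omega⟩
    · exact ⟨v + 1, by omega⟩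
  · exact ⟨v - 1, by omega⟩
  · exact ⟨v + 1, by omega⟩
  · by_cases hvk' : v + 3 ≤ k
    · exact ⟨v + 3, by omega⟩
    · exact ⟨v - 1, by omega⟩
  · exact ⟨v + 1, by omega⟩
  · exact ⟨v - 1, by omega⟩
  · omega
  · omega

/-! ### The robbers -/

/-- The robbers can avoid that all are captured within `t` rounds, from any position in which the
cop is on `x` and each robber `j ∈ S` is on `p j`. -/
def Evades (n t x : ℕ) {m : ℕ} (S : Finset (Fin m)) (p : Fin m → ℕ) : Prop :=
  ∀ (c : Fin 1 → Set.Icc 1 n) (r : Fin m → Option (Set.Icc 1 n)), (c 0 : ℕ) = x →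
    (∀ j ∈ S, ∃ v, r j = some v ∧ (v : ℕ) = p j) → ¬ CopsWinIn (graphH n) t c r

theorem Evades.zero {n x m : ℕ} {S : Finset (Fin m)} (hS : S.Nonempty) (p : Fin m → ℕ) :
    Evades n 0 x S p := by
  intro c r _ hr h
  obtain ⟨j, hj⟩ := hS
  obtain ⟨v, hv, _⟩ := hr j hj
  have := h j
  simp [hv] at this

theorem capture_of_ne {V : Type*} {m : ℕ} {c : Fin 1 → V} {r : Fin m → Option V} {j : Fin m}
    {v : V} (hr : r j = some v) (hv : v ≠ c 0) : capture c r j = some v := by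
  unfold capture
  rw [if_neg, hr]
  rintro ⟨i, hi⟩
  rw [Subsingleton.elim i 0, hr] at hi
  exact hv (Option.some.inj hi)

/-- Robbers outside S' may be given up: they stay put if still free, and `Evades` assumes nothing
about them. -/
theorem Evades.succ {n t x m : ℕ} {S : Finset (Fin m)} {p : Fin m → ℕ} (hS : S.Nonempty)
    (h : ∀ x', 1 ≤ x' → x' ≤ n → Near x x' → ∃ S' ⊆ S, ∃ p' : Fin m → ℕ,
      (∀ j ∈ S', p j ≠ x' ∧ 1 ≤ p' j ∧ p' j ≤ n ∧ Near (p j) (p' j) ∧ p' j ≠ x') ∧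
      Evades n t x' S' p') :
    Evades n (t + 1) x S p := by
  intro c r hc hr hw
  rcases hw with hw | ⟨c', hcc, hw⟩
  · exact Evades.zero hS p c r hc hr hw
  obtain ⟨S', hSS, p', hp, hE⟩ := h (c' 0) (c' 0).2.1 (c' 0).2.2
    (hc ▸ (step_graphH_iff _ _).1 (hcc 0))
  choose v hv hvp using hr
  have hcap : ∀ j (hj : j ∈ S'), capture c' r j = some (v j (hSS hj)) := fun j hj =>
    capture_of_ne (hv j (hSS hj)) fun e => (hp j hj).1 (by rw [← hvp j (hSS hj), e])
  classical
  let r' : Fin m → Option (Set.Icc 1 n) := fun j =>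
    if hj : j ∈ S' then some ⟨p' j, (hp j hj).2.1, (hp j hj).2.2.1⟩ else capture c' r j
  refine hE c' (capture c' r') rfl (fun j hj => ?_) (hw r' fun j => ?_)
  · refine ⟨⟨p' j, (hp j hj).2.1, (hp j hj).2.2.1⟩, capture_of_ne (dif_pos hj) fun e => ?_, rfl⟩
    exact (hp j hj).2.2.2.2 (congrArg Subtype.val e)
  · by_cases hj : j ∈ S'
    · simp only [r', dif_pos hj]
      rw [hcap j hj]
      refine Option.Rel.some ((step_graphH_iff _ _).2 ?_)
      rw [hvp j (hSS hj)]
      exact (hp j hj).2.2.2.1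
    · simp only [r', dif_neg hj]
      cases capture c' r j
      · exact Option.Rel.none
      · exact Option.Rel.some (Or.inl rfl)

/-- A step in which the robbers of `S` move together. -/
theorem Evades.succ_const {n t x m v : ℕ} {S : Finset (Fin m)} (hS : S.Nonempty)
    (h : ∀ x', 1 ≤ x' → x' ≤ n → Near x x' → v ≠ x' ∧ ∃ w, 1 ≤ w ∧ w ≤ n ∧ Near v w ∧ w ≠ x' ∧
      Evades n t x' S fun _ => w) :
    Evades n (t + 1) x S fun _ => v := by
  refine Evades.succ hS fun x' h1 h2 h3 => ?_
  obtain ⟨hv, w, w1, w2, w3, w4, w5⟩ := h x' h1 h2 h3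
  exact ⟨S, Finset.Subset.rfl, fun _ => w, fun j _ => ⟨hv, w1, w2, w3, w4⟩, w5⟩

theorem ne_of_not_near {a b : ℕ} (h : ¬ Near a b) : b ≠ a := fun e => h (Or.inl e.symm)

/-- The robbers keep at distance `2` from the cop until the cop comes down to `1` or `2`. -/
theorem evades_of_distance_two {n m T : ℕ} (hn : 10 ≤ n) {S : Finset (Fin m)} (hS : S.Nonempty)
    (hT : ∀ t x v, t ≤ T → 1 ≤ x → 1 ≤ v → v ≤ 6 → ¬ Near (shadow 6 x) v →
      Evades n t x S fun _ => v) :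
    ∀ (t i x v : ℕ), t ≤ i + T → 4 * i ≤ x + 1 → 3 ≤ x → x ≤ n → 1 ≤ v → v ≤ n →
      ¬ (x = 3 ∧ v = 1) → (x + 2 = v ∨ v + 2 = x) → Evades n t x S fun _ => v := by
  intro t
  induction t with
  | zero => intros; exact Evades.zero hS _
  | succ t ih =>
    intro i x v hti hi hx hxn hv hvn h31 hxv
    refine Evades.succ_const hS fun x' h1 h2 h3 => ⟨?_, ?_⟩
    · unfold Near at h3; omega
    -- A cop arriving at 1 or 2 comes from x ≤ 6, so 4 * i ≤ x + 1 forces i ≤ 1 and at most T rounds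
    -- remain after this one.
    have hdown : x ≤ x' + 4 := by unfold Near at h3; omega
    by_cases hx' : x' ≤ 2
    · have key : ∀ w, 1 ≤ w → w ≤ 6 → Near v w → ¬ Near x' w →
          ∃ w, 1 ≤ w ∧ w ≤ n ∧ Near v w ∧ w ≠ x' ∧ Evades n t x' S fun _ => w := by
        intro w w1 w2 w3 w4
        refine ⟨w, w1, by omega, w3, ne_of_not_near w4, hT t x' w (by omega) h1 w1 w2 ?_⟩
        rwa [shadow_of_le (by omega)]
      unfold Near at key h3
      by_cases hx1 : x' = 1
      · exact key 6 (by omega) (by omega) (by omega) (by omega)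
      · exact key 4 (by omega) (by omega) (by omega) (by omega)
    · have key : ∀ w, 1 ≤ w → w ≤ n → Near v w → ¬ (x' = 3 ∧ w = 1) →
          (x' + 2 = w ∨ w + 2 = x') →
          ∃ w, 1 ≤ w ∧ w ≤ n ∧ Near v w ∧ w ≠ x' ∧ Evades n t x' S fun _ => w := by
        intro w w1 w2 w3 w4 w5
        exact ⟨w, w1, w2, w3, by omega,
          ih (i - 1) x' w (by omega) (by omega) (by omega) h2 w1 w2 w4 w5⟩
      unfold Near at key h3
      -- The group copies the cop's move and stays on its side. It changes side only if the copy
      -- would leave {1, …, n} or land on 1 next to a cop on 3.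
      by_cases hw : 1 ≤ x' - 2 ∧ ¬ x' = 3 ∧ (v + 2 = x ∨ n < x' + 2)
      · exact key (x' - 2) (by omega) (by omega) (by omega) (by omega) (by omega)
      · exact key (x' + 2) (by omega) (by omega) (by omega) (by omega) (by omega)

/-- A group of robbers on a vertex that the cop does not control climbs with the retractions of the
cop's position. They can be cornered on `n` only, by the cop on `n - 4`. -/
theorem evades_of_corner {n m B : ℕ} (hn : 10 ≤ n) {S : Finset (Fin m)} (hS : S.Nonempty)
    (hB : ∀ t ≤ B, (∀ t' < t, ∀ x v, 1 ≤ x → x ≤ n → 1 ≤ v → v ≤ n → ¬ Near x v →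
        Evades n t' x S fun _ => v) →
      ∃ p : Fin m → ℕ, (∀ j ∈ S, 1 ≤ p j ∧ p j ≤ n ∧ Near n (p j) ∧ p j ≠ n - 4) ∧
        Evades n t (n - 4) S p) :
    ∀ (t k x v : ℕ), 6 ≤ k → k ≤ n → 1 ≤ x → x ≤ n → 1 ≤ v → v ≤ k → ¬ Near (shadow k x) v →
      t + k ≤ n + 1 + B → Evades n t x S fun _ => v := by
  intro t
  induction t using Nat.strong_induction_on with
  | _ t ih =>
  intro k x v hk hkn hx hxn hv hvk hnear ht
  rcases t with _ | t
  · exact Evades.zero hS _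
  refine Evades.succ hS fun x' h1 h2 h3 => ?_
  have hne : shadow k x' ≠ v := fun e => hnear (e ▸ shadow_near hk h3)
  have hne' : v ≠ x' := by
    rintro rfl
    exact hne (shadow_of_le hvk)
  rcases hkn.eq_or_lt with rfl | hkn
  · rw [shadow_of_le h2] at hne
    by_cases hc : v = k ∧ x' + 4 = k
    · obtain ⟨rfl, hc⟩ := hc
      obtain rfl : x' = v - 4 := by omega
      obtain ⟨p, hp, hE⟩ := hB t (by omega) fun t' ht' y w y1 y2 w1 w2 hyw =>
        ih t' (by omega) v y w hk le_rfl y1 y2 w1 w2 (by rwa [shadow_of_le y2]) (by omega)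
      exact ⟨S, Finset.Subset.rfl, p, fun j hj => ⟨hne', hp j hj⟩, hE⟩
    · obtain ⟨w, w1, w2, w3, w4⟩ :=
        exists_near_not_near (by omega) h1 hv h2 hvk hne hc
      exact ⟨S, Finset.Subset.rfl, fun _ => w,
        fun j _ => ⟨hne', w1, w2, w3, ne_of_not_near w4⟩,
        ih t (by omega) k x' w hk le_rfl h1 h2 w1 w2 (by rwa [shadow_of_le h2]) (by omega)⟩
  -- While k < n the exceptional case cannot occur: the corner of H(k + 1) is k + 1, but v ≤ k.
  · obtain ⟨w, w1, w2, w3, w4⟩ :=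
      exists_near_not_near (k := k + 1) (u := shadow (k + 1) x') (v := v) (by omega)
        (shadow_pos (by omega) h1) hv (shadow_le (by omega)) (by omega)
        (fun e => hne (shadow_eq_of_shadow_succ_eq hk hvk e)) (by omega)
    refine ⟨S, Finset.Subset.rfl, fun _ => w, fun j _ => ⟨hne', w1, w2.trans hkn, w3, ?_⟩,
      ih t (by omega) (k + 1) x' w (by omega) hkn h1 h2 w1 w2 w4 (by omega)⟩
    rintro rfl
    exact w4 (Or.inl (shadow_of_le w2))

/-- The robbers evade for `n + 1 - k` rounds, plus `n + l - 4` rounds for every time that their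
number can be halved. -/
theorem evades_of_level {l n m : ℕ} (hl : 2 ≤ l) (hn : n = 4 * l + 2) (s : ℕ) :
    ∀ (S : Finset (Fin m)), 2 ^ s ≤ S.card → ∀ (t k x v : ℕ), 6 ≤ k → k ≤ n → 1 ≤ x → x ≤ n →
      1 ≤ v → v ≤ k → ¬ Near (shadow k x) v → t + k ≤ n + 1 + s * (n + l - 4) →
      Evades n t x S fun _ => v := by
  induction s with
  | zero =>
    intro S hcard
    have hS : S.Nonempty := Finset.card_pos.1 (by simpa using hcard)
    refine evades_of_corner (by omega) hS fun t ht _ => ⟨fun _ => n, fun j _ => ?_, ?_⟩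
    · exact ⟨by dsimp only; omega, le_rfl, Or.inl rfl, by dsimp only; omega⟩
    · obtain rfl : t = 0 := by omega
      exact Evades.zero hS _
  | succ s ihs =>
    intro S hcard
    have hpow : 0 < 2 ^ s := by positivity
    have hS : S.Nonempty := Finset.card_pos.1 (by rw [pow_succ] at hcard; omega)
    have hmul : (s + 1) * (n + l - 4) = s * (n + l - 4) + (n + l - 4) := Nat.succ_mul _ _
    obtain ⟨A, hAS, hA⟩ := Finset.exists_subset_card_eq (s := S) (n := 2 ^ s)
      (by rw [pow_succ] at hcard; omega)
    have hAc : 2 ^ s ≤ (S \ A).card := by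
      rw [Finset.card_sdiff_of_subset hAS, hA]
      rw [pow_succ] at hcard
      omega
    -- The cop has just taken one half from n - 1 or n - 3, so x ≥ n - 3 = 4 * l - 1 and the descent
    -- lasts at least l rounds. T is the time granted by the induction hypothesis from level 6.
    have flee : ∀ (t x v : ℕ) (A : Finset (Fin m)), 2 ^ s ≤ A.card → 4 * l ≤ x + 1 → x ≤ n →
        1 ≤ v → v ≤ n → (x + 2 = v ∨ v + 2 = x) → t + 1 ≤ (s + 1) * (n + l - 4) →
        Evades n t x A fun _ => v := by
      intro t x v A hA hx hxn hv hvn hxv ht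
      refine evades_of_distance_two (T := s * (n + l - 4) + (n - 5)) (by omega)
        (Finset.card_pos.1 (by omega)) ?_ t l x v (by omega) hx (by omega) hxn hv hvn
        (by omega) hxv
      intro t x v ht hx hv hv6 hnear
      by_cases hxn : x ≤ n
      -- For x > n the claim is vacuous, as no cop can stand there.
      · exact ihs A hA t 6 x v le_rfl (by omega) hx hxn hv hv6 hnear (by omega)
      · intro c _ hc
        exact absurd (hc ▸ (c 0).2.2) hxn
    -- With the cop on n - 4, the group on n splits between its neighbours n - 1 and n - 3, which
    -- differ by 2.
    refine evades_of_corner (by omega) hS fun t ht ih =>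
      ⟨fun j => if j ∈ A then n - 1 else n - 3, fun j _ => ?_, ?_⟩
    · unfold Near
      dsimp only
      split_ifs <;> omega
    rcases t with _ | t
    · exact Evades.zero hS _
    refine Evades.succ hS fun x' h1 h2 h3 => ?_
    by_cases hx1 : x' = n - 1
    · refine ⟨S \ A, Finset.sdiff_subset, fun _ => n - 3, fun j hj => ?_,
        flee t x' _ _ hAc (by omega) h2 (by omega) (by omega) (by omega) (by omega)⟩
      rw [if_neg (Finset.mem_sdiff.1 hj).2]
      unfold Near
      dsimp only
      omega
    by_cases hx3 : x' = n - 3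
    · refine ⟨A, hAS, fun _ => n - 1, fun j hj => ?_,
        flee t x' _ _ hA.ge (by omega) h2 (by omega) (by omega) (by omega) (by omega)⟩
      rw [if_pos hj]
      unfold Near
      dsimp only
      omega
    -- If the cop takes neither half, the whole group reunites on a common neighbour w not near the
    -- cop. No robber is lost, so the induction on t applies rather than the one on s.
    have merge : ∀ w, 1 ≤ w → w ≤ n → Near (n - 1) w → Near (n - 3) w → ¬ Near x' w →
        ∃ S' ⊆ S, ∃ p' : Fin m → ℕ, (∀ j ∈ S', (if j ∈ A then n - 1 else n - 3) ≠ x' ∧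
          1 ≤ p' j ∧ p' j ≤ n ∧ Near (if j ∈ A then n - 1 else n - 3) (p' j) ∧ p' j ≠ x') ∧
          Evades n t x' S' p' := by
      intro w w1 w2 w3 w4 w5
      refine ⟨S, Finset.Subset.rfl, fun _ => w, fun j _ => ?_,
        ih t (by omega) x' w h1 h2 w1 w2 w5⟩
      have := ne_of_not_near w5
      split_ifs
      · exact ⟨Ne.symm hx1, w1, w2, w3, this⟩
      · exact ⟨Ne.symm hx3, w1, w2, w4, this⟩
    unfold Near at h3
    -- Among the moves left to a cop on n - 4, only n - 5 is near n - 2.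
    by_cases hx5 : x' = n - 5
    · refine merge n (by omega) le_rfl ?_ ?_ ?_ <;> (unfold Near; omega)
    · refine merge (n - 2) (by omega) (by omega) ?_ ?_ ?_ <;> (unfold Near; omega)

theorem le_of_copsGuarantee {l n m s t : ℕ} (hl : 2 ≤ l) (hn : n = 4 * l + 2) (hm : 2 ^ s ≤ m)
    (h : CopsGuarantee (graphH n) 1 m t) : s * (l + n - 4) ≤ t := by
  by_contra! ht
  obtain ⟨c, hc⟩ := h
  have hcomm : l + n - 4 = n + l - 4 := by omega
  rw [hcomm] at ht
  have h1 := (c 0).2.1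
  have h2 := (c 0).2.2
  have level : ∀ (t x v : ℕ), t ≤ s * (n + l - 4) + (n - 5) → 1 ≤ x → x ≤ n → 1 ≤ v → v ≤ 6 →
      ¬ Near (shadow 6 x) v → Evades n t x (Finset.univ : Finset (Fin m)) fun _ => v :=
    fun t x v ht hx hxn hv hv6 hnear => evades_of_level hl hn s Finset.univ (by simpa using hm)
      t 6 x v le_rfl (by omega) hx hxn hv hv6 hnear (by omega)
  have key : ∃ v, 1 ≤ v ∧ v ≤ n ∧ v ≠ (c 0 : ℕ) ∧
      Evades n t (c 0) (Finset.univ : Finset (Fin m)) fun _ => v := by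
    -- No vertex of H(6) dominates H(6), so against a low cop the robbers start at level 6.
    -- Otherwise they start two below the cop; no time need be gained on the descent, hence i = 0
    -- below.
    by_cases hx : (c 0 : ℕ) ≤ 6
    · have : ∃ v, 1 ≤ v ∧ v ≤ 6 ∧ ¬ Near (c 0) v := by
        generalize (c 0 : ℕ) = x at *
        unfold Near
        interval_cases x
        exacts [⟨6, by omega⟩, ⟨4, by omega⟩, ⟨5, by omega⟩, ⟨2, by omega⟩, ⟨3, by omega⟩,
          ⟨1, by omega⟩]
      obtain ⟨v, v1, v2, v3⟩ := this
      exact ⟨v, v1, by omega, ne_of_not_near v3,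
        level t _ v (by omega) h1 h2 v1 v2 (by rwa [shadow_of_le hx])⟩
    · refine ⟨c 0 - 2, by omega, by omega, by omega, ?_⟩
      refine evades_of_distance_two (T := s * (n + l - 4) + (n - 5)) (by omega)
        ⟨⟨0, lt_of_lt_of_le (by positivity) hm⟩, Finset.mem_univ _⟩ ?_ t 0 _ _ (by omega)
        (by omega) (by omega) h2 (by omega) (by omega) (by omega) (by omega)
      intro t x v ht hx hv hv6 hnear
      by_cases hxn : x ≤ n
      · exact level t x v ht hx hxn hv hv6 hnear
      · intro c _ hc
        exact absurd (hc ▸ (c 0).2.2) hxn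
  obtain ⟨v, v1, v2, v3, hE⟩ := key
  refine hE c _ rfl (fun j _ => ⟨⟨v, v1, v2⟩, ?_, rfl⟩) (hc fun _ => ⟨v, v1, v2⟩)
  exact capture_of_ne rfl fun e => v3 (congrArg Subtype.val e)

/-! ### The cop -/

theorem copsWinIn_of_none {V : Type*} {G : SimpleGraph V} {k m : ℕ} {c : Fin k → V}
    {r : Fin m → Option V} (h : ∀ j, r j = none) (t : ℕ) : CopsWinIn G t c r := by
  cases t
  · exact h
  · exact Or.inl h

theorem CopsRobbers.CopsWinIn.mono {V : Type*} {G : SimpleGraph V} {k m t t' : ℕ}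
    (htt : t ≤ t') :
    ∀ {c : Fin k → V} {r : Fin m → Option V}, CopsWinIn G t c r → CopsWinIn G t' c r := by
  induction t generalizing t' with
  | zero => exact fun h => copsWinIn_of_none h t'
  | succ t ih =>
    obtain ⟨t', rfl⟩ : ∃ d, t' = d + 1 := ⟨t' - 1, by omega⟩
    rintro c r (h | ⟨c', hc, h⟩)
    · exact Or.inl h
    · exact Or.inr ⟨c', hc, fun r' hr => ih (by omega) (h r' hr)⟩

/-- The robbers that are still in the game. -/
def live {V : Type*} {m : ℕ} (r : Fin m → Option V) : Finset (Fin m) :=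
  Finset.univ.filter fun j => (r j).isSome

theorem mem_live {V : Type*} {m : ℕ} {r : Fin m → Option V} {j : Fin m} :
    j ∈ live r ↔ ∃ v, r j = some v := by
  simp [live, Option.isSome_iff_exists]

theorem exists_of_capture {V : Type*} {m : ℕ} {c : Fin 1 → V} {r : Fin m → Option V} {j : Fin m}
    {v : V} (h : capture c r j = some v) : r j = some v ∧ v ≠ c 0 := by
  unfold capture at h
  split_ifs at h with hc
  exact ⟨h, fun e => hc ⟨0, by rw [h, e]⟩⟩

theorem copsWinIn_succ {n t m : ℕ} {c c' : Fin 1 → Set.Icc 1 n}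
    {r : Fin m → Option (Set.Icc 1 n)} (hc : Near (c 0) (c' 0))
    (h : ∀ r' : Fin m → Option (Set.Icc 1 n), (∀ j w, r' j = some w →
      ∃ v, r j = some v ∧ v ≠ c' 0 ∧ Near v w) → CopsWinIn (graphH n) t c' r') :
    CopsWinIn (graphH n) (t + 1) c r := by
  refine Or.inr ⟨c', fun i => ?_, fun r' hr => h _ fun j w hw => ?_⟩
  · rw [Subsingleton.elim i 0]
    exact (step_graphH_iff _ _).2 hc
  · obtain ⟨hw, _⟩ := exists_of_capture hw
    have hj := hr j
    rw [hw] at hj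
    generalize hv : capture c' r j = o at hj
    cases hj with
    | some hs =>
      obtain ⟨hv, hne⟩ := exists_of_capture hv
      exact ⟨_, hv, hne, (step_graphH_iff _ _).1 hs⟩

theorem live_subset {V : Type*} {m : ℕ} {r r' : Fin m → Option V} {P : V → V → Prop}
    (h : ∀ j w, r' j = some w → ∃ v, r j = some v ∧ P v w) : live r' ⊆ live r := by
  intro j hj
  obtain ⟨w, hw⟩ := mem_live.1 hj
  obtain ⟨v, hv, _⟩ := h j w hw
  exact mem_live.2 ⟨v, hv⟩

/-- If the cop can reach the image of a robber under the retraction onto `H(k)`, then he captures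
that robber within `n + 1 - k` rounds. -/
theorem copsWinIn_of_near_shadow {n m a B : ℕ}
    (hB : ∀ (c : Fin 1 → Set.Icc 1 n) (r : Fin m → Option (Set.Icc 1 n)), (live r).card ≤ a →
      CopsWinIn (graphH n) B c r) (j : Fin m) :
    ∀ (d : ℕ) (c : Fin 1 → Set.Icc 1 n) (r : Fin m → Option (Set.Icc 1 n)) (v : Set.Icc 1 n),
      6 + d ≤ n → (live r).card ≤ a + 1 → r j = some v → Near (c 0) (shadow (n - d) v) →
      CopsWinIn (graphH n) (B + 1 + d) c r := by
  intro d
  induction d with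
  | zero =>
    intro c r v _ hr hj hc
    rw [Nat.sub_zero, shadow_of_le v.2.2] at hc
    refine copsWinIn_succ (c' := fun _ => v) hc fun r' hr' => hB _ _ ?_
    have hlt : live r' ⊂ live r := by
      refine ⟨live_subset hr', fun hs => ?_⟩
      obtain ⟨w, hw⟩ := mem_live.1 (hs (mem_live.2 ⟨v, hj⟩))
      obtain ⟨u, hu, hne, _⟩ := hr' j w hw
      exact hne (Option.some.inj (hu.symm.trans hj))
    have := Finset.card_lt_card hlt
    omega
  | succ d ih =>
    intro c r v hd hr hj hc
    have hle : shadow (n - (d + 1)) v ≤ n := (shadow_le (by omega)).trans (by omega)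
    refine copsWinIn_succ (t := B + 1 + d)
      (c' := fun _ => ⟨_, shadow_pos (by omega) v.2.1, hle⟩) hc fun r' hr' => ?_
    have hcard := Finset.card_le_card (live_subset hr')
    cases hj' : r' j with
    | none =>
      refine (hB _ r' ?_).mono (by omega)
      have hlt : live r' ⊂ live r := by
        refine ⟨live_subset hr', fun hs => ?_⟩
        obtain ⟨w, hw⟩ := mem_live.1 (hs (mem_live.2 ⟨v, hj⟩))
        rw [hj'] at hw
        cases hw
      have := Finset.card_lt_card hlt
      omega
    | some w =>
      obtain ⟨u, hu, _, huw⟩ := hr' j w hj'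
      obtain rfl : u = v := Option.some.inj (hu.symm.trans hj)
      refine ih _ r' w (by omega) (by omega) hj' ?_
      have := shadow_near_shadow_succ (k := n - (d + 1)) (by omega) huw
      rwa [show n - (d + 1) + 1 = n - d by omega] at this

/-- The retraction of `H(n)` onto `{1, …, 5}`, all of whose vertices are adjacent to `1`. -/
def lowShadow (x : ℕ) : ℕ := if shadow 6 x = 6 then 2 else shadow 6 x

theorem near_one_lowShadow {x : ℕ} (hx : 1 ≤ x) : 1 ≤ lowShadow x ∧ Near 1 (lowShadow x) := by
  have h1 := shadow_pos le_rfl hx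
  have h2 : shadow 6 x ≤ 6 := shadow_le le_rfl
  unfold Near lowShadow
  split_ifs <;> omega

/-- The extra fold sends 6 to 2, which is near every neighbour of 6 in H(6). -/
theorem lowShadow_near_shadow {x y : ℕ} (hx : 1 ≤ x) (hy : 1 ≤ y) (h : Near x y) :
    Near (lowShadow x) (shadow 6 y) := by
  have h0 := shadow_near le_rfl h
  have h1 := shadow_pos le_rfl hx
  have h2 : shadow 6 x ≤ 6 := shadow_le le_rfl
  have h3 := shadow_pos le_rfl hy
  have h4 : shadow 6 y ≤ 6 := shadow_le le_rfl
  unfold lowShadow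
  unfold Near at *
  split_ifs <;> omega

/-- The cop walks down to 1 by unit steps, then catches one arbitrarily chosen robber. The
retraction of that robber to {1, …, 5} is within reach from 1. -/
theorem copsWinIn_of_cop_le {n m a B : ℕ} (hn : 6 ≤ n)
    (hB : ∀ (c : Fin 1 → Set.Icc 1 n) (r : Fin m → Option (Set.Icc 1 n)), (live r).card ≤ a →
      CopsWinIn (graphH n) B c r) :
    ∀ (i : ℕ) (c : Fin 1 → Set.Icc 1 n) (r : Fin m → Option (Set.Icc 1 n)),
      (c 0 : ℕ) ≤ i + 1 → (live r).card ≤ a + 1 → CopsWinIn (graphH n) (B + n + i) c r := by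
  intro i
  induction i with
  | zero =>
    intro c r hc hr
    have hc1 : (c 0 : ℕ) = 1 := le_antisymm hc (c 0).2.1
    by_cases hl : live r = ∅
    · refine (hB c r ?_).mono (by omega)
      simp [hl]
    obtain ⟨j, hj⟩ := Finset.nonempty_iff_ne_empty.2 hl
    obtain ⟨v, hv⟩ := mem_live.1 hj
    obtain ⟨hv0, hv1⟩ := near_one_lowShadow v.2.1
    have hlow : 1 ≤ lowShadow v ∧ lowShadow v ≤ n := by
      unfold Near at hv1
      omega
    refine CopsWinIn.mono (t := (B + 1 + (n - 6)) + 1) (by omega)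
      (copsWinIn_succ (c' := fun _ => ⟨_, hlow⟩) (by rwa [hc1]) fun r' hr' => ?_)
    have hcard := Finset.card_le_card (live_subset hr')
    cases hj' : r' j with
    | none =>
      refine (hB _ r' ?_).mono (by omega)
      have hlt : live r' ⊂ live r := by
        refine ⟨live_subset hr', fun hs => ?_⟩
        obtain ⟨w, hw⟩ := mem_live.1 (hs hj)
        rw [hj'] at hw
        cases hw
      have := Finset.card_lt_card hlt
      omega
    | some w =>
      obtain ⟨u, hu, _, huw⟩ := hr' j w hj'
      obtain rfl : u = v := Option.some.inj (hu.symm.trans hv)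
      refine copsWinIn_of_near_shadow hB j (n - 6) _ r' w (by omega) (by omega) hj' ?_
      rw [show n - (n - 6) = 6 by omega]
      exact lowShadow_near_shadow u.2.1 w.2.1 huw
  | succ i ih =>
    intro c r hc hr
    by_cases hc1 : (c 0 : ℕ) = 1
    · exact (ih c r (by omega) hr).mono (by omega)
    have h1 := (c 0).2.1
    have h2 := (c 0).2.2
    refine copsWinIn_succ (c' := fun _ => ⟨(c 0 : ℕ) - 1, by omega, by omega⟩) ?_
      fun r' hr' => ih _ r' (Nat.sub_le_iff_le_add.2 hc)
        ((Finset.card_le_card (live_subset hr')).trans hr)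
    unfold Near
    dsimp only
    omega

theorem exists_copsWinIn {n m : ℕ} (hn : 6 ≤ n) (a : ℕ) :
    ∃ t, ∀ (c : Fin 1 → Set.Icc 1 n) (r : Fin m → Option (Set.Icc 1 n)), (live r).card ≤ a →
      CopsWinIn (graphH n) t c r := by
  induction a with
  | zero =>
    refine ⟨0, fun c r hr j => ?_⟩
    by_contra hj
    have hmem : j ∈ live r := mem_live.2 (Option.ne_none_iff_exists'.1 hj)
    rw [Finset.card_eq_zero.1 (Nat.le_zero.1 hr)] at hmem
    exact absurd hmem (Finset.notMem_empty j)
  | succ a ih =>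
    obtain ⟨B, hB⟩ := ih
    exact ⟨B + n + n, fun c r hr => copsWinIn_of_cop_le hn hB n c r ((c 0).2.2.trans (by omega)) hr⟩

theorem capt_graphH_ne_top {n : ℕ} (hn : 6 ≤ n) (m : ℕ) : capt (graphH n) 1 m ≠ ⊤ := by
  obtain ⟨t, ht⟩ := exists_copsWinIn (m := m) hn m
  have : CopsGuarantee (graphH n) 1 m t :=
    ⟨fun _ => ⟨1, le_rfl, by omega⟩, fun r =>
      ht _ _ ((Finset.card_le_univ _).trans (by simp))⟩
  have hle : capt (graphH n) 1 m ≤ (t : ℕ∞) := sInf_le (Set.mem_image_of_mem _ this)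
  exact (hle.trans_lt (ENat.natCast_lt_top t)).ne

/-! ### Unbounded capture times -/

theorem mainTheorem5 (l n : ℕ) (hl : 2 ≤ l) (hn : n = 4 * l + 2) :
    (∀ m : ℕ, 1 ≤ m → CopsRobbers.capt (graphH n) 1 m ≠ ⊤) ∧
    (∀ s : ℕ, 1 ≤ s →
      ((s * (l + n - 4) : ℕ) : ℕ∞) ≤ CopsRobbers.capt (graphH n) 1 (3 ^ s)) ∧
    (∀ B : ℕ, ∃ m : ℕ, 1 ≤ m ∧ (B : ℕ∞) < CopsRobbers.capt (graphH n) 1 m) ∧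
    ¬ CopsRobbers.IsStrongCopWin (graphH n) 1 := by
  have lower : ∀ s : ℕ, ((s * (l + n - 4) : ℕ) : ℕ∞) ≤ capt (graphH n) 1 (3 ^ s) := by
    intro s
    refine le_sInf ?_
    rintro _ ⟨t, ht, rfl⟩
    exact Nat.cast_le.2 (le_of_copsGuarantee hl hn (Nat.pow_le_pow_left (by norm_num) s) ht)
  have large : ∀ B s : ℕ, B < s → (B : ℕ∞) < capt (graphH n) 1 (3 ^ s) := fun B s hs =>
    (Nat.cast_lt.2 (hs.trans_le (Nat.le_mul_of_pos_right s (by omega)))).trans_le (lower s)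
  refine ⟨fun m _ => capt_graphH_ne_top (by omega) m, fun s _ => lower s,
    fun B => ⟨3 ^ (B + 1), Nat.one_le_pow _ _ (by norm_num), large B (B + 1) B.lt_succ_self⟩, ?_⟩
  rintro ⟨L, hL⟩
  -- A finite limit L would keep the capture times eventually below L + 1, which fails along m = 3 ^
  -- s.
  have hev : ∀ᶠ m in atTop, capt (graphH n) 1 m < ((L + 1 : ℕ) : ℕ∞) :=
    hL.eventually (gt_mem_nhds (Nat.cast_lt.2 L.lt_succ_self))
  have hpow : Tendsto (fun s : ℕ => 3 ^ s) atTop atTop :=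
    tendsto_pow_atTop_atTop_of_one_lt (by norm_num)
  obtain ⟨s, h1, h2⟩ := ((hpow.eventually hev).and (eventually_gt_atTop (L + 1))).exists
  exact lt_asymm h1 (large (L + 1) s h2)
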